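/- Let $X$ and $Y$ be complex Banach spaces, and let $\mathcal B(Y,X)$ be the space of bounded linear operators from $Y$ to $X$, $\mathcal B(X)=\mathcal B(X,X)$. An operator $T\in\mathcal B(X)$ has the single valued extension property (SVEP) if for every open set $U\subseteq\mathbb C$ the only analytic function $f:U\to X$ with $(T-zI)f(z)=0$ for all $z\in U$ is $f\equiv 0$. $T$ is called left (resp. right) generalized Drazin invertible if there are closed $T$-invariant subspaces $X_1,X_2$ with $X=X_1\oplus X_2$ such that $T|_{X_1}$ is left (resp. right) invertible in $\mathcal B(X_1)$ and $T|_{X_2}$ is quasi-nilpotent (that is, has spectral radius $0$; the subspaces may be $\{0\}$). Put $$\sigma_{lgD}(T)=\{\lambda\in\mathbb C: T-\lambda I\text{ is not left generalized Drazin invertible}\},$$ $$\sigma_{rgD}(T)=\{\lambda\in\mathbb C: T-\lambda I\text{ is not right generalized Drazin invertible}\}.$$ For $A\in\mathcal B(X)$, $B\in\mathcal B(Y)$, $C\in\mathcal B(Y,X)$ let $M_C=\begin{pmatrix}A&C\\0&B\end{pmatrix}\in\mathcal B(X\oplus Y)$, that is, $M_C(x,y)=(Ax+Cy,By)$. (i)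 If $A\in\mathcal B(X)$ is such that its Banach space adjoint $A^*\in\mathcal B(X^*)$ has the SVEP, then for every $B\in\mathcal B(Y)$ and every $C\in\mathcal B(Y,X)$, $$\sigma_{lgD}(M_C)=\sigma_{lgD}(A)\cup\sigma_{lgD}(B).$$ (ii) If $B\in\mathcal B(Y)$ has the SVEP, then for every $A\in\mathcal B(X)$ and every $C\in\mathcal B(Y,X)$, $$\sigma_{rgD}(M_C)=\sigma_{rgD}(A)\cup\sigma_{rgD}(B).$$ -/

import Mathlib

namespace GenDrazin

noncomputable section

/-- A bounded operator `T` on a complex normed space has the single valued extension property: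
for every open set `U ⊆ ℂ`, the only analytic `f : U → X` with `(T - z) f(z) = 0` on `U` is
`f ≡ 0`. (Every open set is considered, so this is SVEP at every point of `ℂ`.) -/
def HasSVEP {X : Type*} [NormedAddCommGroup X] [NormedSpace ℂ X] (T : X →L[ℂ] X) : Prop :=
  ∀ (U : Set ℂ) (f : ℂ → X), IsOpen U → AnalyticOnNhd ℂ f U →
    (∀ z ∈ U, (T - z • ContinuousLinearMap.id ℂ X) (f z) = 0) → ∀ z ∈ U, f z = 0

/-- The Banach space adjoint `T* φ = φ ∘ T` on the dual space `X*`. -/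
def adj {X : Type*} [NormedAddCommGroup X] [NormedSpace ℂ X] (T : X →L[ℂ] X) :
    StrongDual ℂ X →L[ℂ] StrongDual ℂ X :=
  ContinuousLinearMap.precomp ℂ T

/-- `T` is quasi-nilpotent: its spectral radius is zero. -/
def IsQuasinilpotent {X : Type*} [NormedAddCommGroup X] [NormedSpace ℂ X]
    (T : X →L[ℂ] X) : Prop :=
  spectralRadius ℂ T = 0

/-- `T` has a bounded left inverse. -/
def IsLeftInvertible {X : Type*} [NormedAddCommGroup X] [NormedSpace ℂ X]
    (T : X →L[ℂ] X) : Prop :=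
  ∃ S : X →L[ℂ] X, S ∘L T = ContinuousLinearMap.id ℂ X

/-- `T` has a bounded right inverse. -/
def IsRightInvertible {X : Type*} [NormedAddCommGroup X] [NormedSpace ℂ X]
    (T : X →L[ℂ] X) : Prop :=
  ∃ S : X →L[ℂ] X, T ∘L S = ContinuousLinearMap.id ℂ X

/-- `T` is left generalized Drazin invertible: `X = X₁ ⊕ X₂` with closed `T`-invariant subspaces
such that `T|X₁` is left invertible and `T|X₂` is quasi-nilpotent. -/
def IsLeftGenDrazin {X : Type*} [NormedAddCommGroup X] [NormedSpace ℂ X]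
    (T : X →L[ℂ] X) : Prop :=
  ∃ (X₁ X₂ : Submodule ℂ X) (h₁ : ∀ x ∈ X₁, T x ∈ X₁) (h₂ : ∀ x ∈ X₂, T x ∈ X₂),
    IsClosed (X₁ : Set X) ∧ IsClosed (X₂ : Set X) ∧ IsCompl X₁ X₂ ∧
      IsLeftInvertible (T.restrict h₁) ∧ IsQuasinilpotent (T.restrict h₂)

/-- `T` is right generalized Drazin invertible: `X = X₁ ⊕ X₂` with closed `T`-invariant subspaces
such that `T|X₁` is right invertible and `T|X₂` is quasi-nilpotent. -/
def IsRightGenDrazin {X : Type*} [NormedAddCommGroup X] [NormedSpace ℂ X]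
    (T : X →L[ℂ] X) : Prop :=
  ∃ (X₁ X₂ : Submodule ℂ X) (h₁ : ∀ x ∈ X₁, T x ∈ X₁) (h₂ : ∀ x ∈ X₂, T x ∈ X₂),
    IsClosed (X₁ : Set X) ∧ IsClosed (X₂ : Set X) ∧ IsCompl X₁ X₂ ∧
      IsRightInvertible (T.restrict h₁) ∧ IsQuasinilpotent (T.restrict h₂)

/-- The left generalized Drazin spectrum. -/
def leftGenDrazinSpectrum {X : Type*} [NormedAddCommGroup X] [NormedSpace ℂ X]
    (T : X →L[ℂ] X) : Set ℂ :=
  {z : ℂ | ¬ IsLeftGenDrazin (T - z • ContinuousLinearMap.id ℂ X)}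

/-- The right generalized Drazin spectrum. -/
def rightGenDrazinSpectrum {X : Type*} [NormedAddCommGroup X] [NormedSpace ℂ X]
    (T : X →L[ℂ] X) : Set ℂ :=
  {z : ℂ | ¬ IsRightGenDrazin (T - z • ContinuousLinearMap.id ℂ X)}

/-- The upper triangular operator matrix `(x, y) ↦ (A x + C y, B y)` on `X ⊕ Y`. -/
def opMatrix {X Y : Type*} [NormedAddCommGroup X] [NormedSpace ℂ X]
    [NormedAddCommGroup Y] [NormedSpace ℂ Y]
    (A : X →L[ℂ] X) (B : Y →L[ℂ] Y) (C : Y →L[ℂ] X) : (X × Y) →L[ℂ] (X × Y) :=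
  (A ∘L ContinuousLinearMap.fst ℂ X Y + C ∘L ContinuousLinearMap.snd ℂ X Y).prod
    (B ∘L ContinuousLinearMap.snd ℂ X Y)

end

end GenDrazin

/-! Everything is recast in terms of idempotents: `T` is left generalized Drazin invertible iff some
idempotent `P` commutes with `T`, `T * P` is quasi-nilpotent and `T + P` is left invertible
(`isLeftGenDrazin_iff`). Such a `T` has `T - w` left invertible for all small `w ≠ 0`.

If `M_C - z` is left generalized Drazin invertible, compressing left inverses to `X` shows that `A -
z - w` is left invertible for small `w ≠ 0`; if `A - z` is, the same holds directly. The SVEP of the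
adjoint turns these left inverses into inverses, so `z` is at worst an isolated point of the
spectrum of `A`, and the Riesz projection makes `A - z` two-sidedly generalized Drazin invertible.
Both inclusions may therefore assume this.

The rest is algebra resting on one fact: `W ↦ W - V W K` is bijective when `V` or `K` is
quasi-nilpotent (`bijective_sub_comp_comp`). Surjectivity supplies the off-diagonal entry of an
idempotent for `M_C` from idempotents for `A` and `B`. Injectivity forces the idempotent of `M_C` to
restrict to that of `A` on `X`, so that it descends to the quotient `Y` and handles `B`.

Part (ii) is the mirror image: the SVEP upgrades right inverses of translates of `B`, and one
restricts to `X` instead of passing to the quotient. -/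

namespace GenDrazin

open Filter Topology Metric

/-! ### Quasi-nilpotence and idempotents in a Banach algebra -/

section BanachAlgebra

variable {R : Type*} [NormedRing R]

/-- The powers of `t` decay faster than every geometric sequence. -/
def PowersDecay (t : R) : Prop :=
  ∀ ε : ℝ, 0 < ε → ∃ C : ℝ, 0 ≤ C ∧ ∀ n : ℕ, ‖t ^ n‖ ≤ C * ε ^ n

theorem powersDecay_of_le {S : Type*} [NormedRing S] {t : R} {s : S} (h : PowersDecay t) {K : ℝ}
    (hK : 0 ≤ K) (hb : ∀ n : ℕ, ‖s ^ (n + 1)‖ ≤ K * ‖t ^ (n + 1)‖) : PowersDecay s := by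
  intro ε hε
  obtain ⟨C, hC, hCb⟩ := h ε hε
  -- The hypothesis starts at exponent 1; the summand `‖1‖` covers exponent 0.
  refine ⟨K * C + ‖(1 : S)‖, by positivity, fun n => ?_⟩
  rcases n with _ | n
  · simp; positivity
  · refine (hb n).trans ((mul_le_mul_of_nonneg_left (hCb (n + 1)) hK).trans ?_)
    rw [← mul_assoc]
    gcongr
    linarith [norm_nonneg (1 : S)]

/-- `p` is an idempotent commuting with `t` on whose range `t` is quasi-nilpotent. -/
structure IsQuasinilpotentProj (t p : R) : Prop where
  idem : p * p = p
  comm : p * t = t * p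
  decay : PowersDecay (t * p)

namespace IsQuasinilpotentProj

variable {t p : R}

theorem one_sub_mul (h : IsQuasinilpotentProj t p) : (1 - p) * (1 - p) = 1 - p := by
  simp [sub_mul, mul_sub, h.idem]

/-- A left inverse of `t + p` gives a left inverse of `t` on the range of `1 - p`. -/
theorem exists_leftInverse (h : IsQuasinilpotentProj t p) {r : R} (hr : r * (t + p) = 1) :
    ∃ l, l * t = 1 - p ∧ l * p = 0 ∧ p * l = 0 := by
  have h1 := h.idem
  have e : (t + p) * (1 - p) = (1 - p) * t := by
    simp only [sub_mul, mul_sub, add_mul, one_mul, mul_one, h1, h.comm]; abel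
  refine ⟨(1 - p) * r * (1 - p), ?_, ?_, ?_⟩
  · rw [mul_assoc, ← e, mul_assoc, ← mul_assoc r, hr, one_mul, h.one_sub_mul]
  · rw [mul_assoc, sub_mul 1 p p, h1]; simp
  · rw [← mul_assoc, ← mul_assoc, mul_sub p, h1]; simp

/-- A right inverse of `t + p` gives a right inverse of `t` on the range of `1 - p`. -/
theorem exists_rightInverse (h : IsQuasinilpotentProj t p) {r : R} (hr : (t + p) * r = 1) :
    ∃ l, t * l = 1 - p ∧ l * p = 0 ∧ p * l = 0 := by
  have h1 := h.idem
  have e : (1 - p) * (t + p) = t * (1 - p) := by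
    simp only [sub_mul, mul_sub, mul_add, one_mul, mul_one, h1, h.comm]; abel
  refine ⟨(1 - p) * r * (1 - p), ?_, ?_, ?_⟩
  · rw [← mul_assoc, ← mul_assoc, ← e, mul_assoc (1 - p), hr, mul_one, h.one_sub_mul]
  · rw [mul_assoc, sub_mul 1 p p, h1]; simp
  · rw [← mul_assoc, ← mul_assoc, mul_sub p, h1]; simp

end IsQuasinilpotentProj

variable [NormedAlgebra ℂ R]

/-- Spectral mapping gives `‖z‖ ^ n ≤ ‖t ^ n‖ * ‖1‖`; decay at rate `‖z‖ / 2` would then bound `2 ^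
n`. -/
theorem PowersDecay.eq_zero_of_mem_spectrum [CompleteSpace R] {t : R} (h : PowersDecay t) {z : ℂ}
    (hz : z ∈ spectrum ℂ t) : z = 0 := by
  by_contra hz0
  have hpos : 0 < ‖z‖ := norm_pos_iff.2 hz0
  obtain ⟨C, hC, hb⟩ := h (‖z‖ / 2) (by positivity)
  have key : ∀ n : ℕ, (2 : ℝ) ^ n ≤ C * ‖(1 : R)‖ := by
    intro n
    have h1 := spectrum.norm_le_norm_mul_of_mem (spectrum.pow_mem_pow t n hz)
    have h2 : ‖z‖ ^ n ≤ C * (‖z‖ / 2) ^ n * ‖(1 : R)‖ := by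
      rw [← norm_pow]
      exact h1.trans (mul_le_mul_of_nonneg_right (hb n) (norm_nonneg _))
    rw [div_pow] at h2
    have h3 : (0 : ℝ) < ‖z‖ ^ n := by positivity
    have h4 : (0 : ℝ) < 2 ^ n := by positivity
    field_simp at h2
    nlinarith
  obtain ⟨n, hn⟩ := pow_unbounded_of_one_lt (C * ‖(1 : R)‖) (one_lt_two (α := ℝ))
  exact absurd (key n) (not_le.2 hn)

theorem spectralRadius_eq_zero_iff {t : R} :
    spectralRadius ℂ t = 0 ↔ ∀ z : ℂ, z ≠ 0 → IsUnit (algebraMap ℂ R z - t) := by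
  unfold spectralRadius
  simp only [ENNReal.iSup_eq_zero]
  constructor
  · intro h z hz
    by_contra hu
    have := h z hu
    simp [hz] at this
  · intro h z hz
    by_contra hz0
    exact hz (h z (by simpa using hz0))

theorem powersDecay_of_spectralRadius_eq_zero [CompleteSpace R] {t : R}
    (h : spectralRadius ℂ t = 0) : PowersDecay t := by
  intro ε hε
  have hlim := spectrum.pow_norm_pow_one_div_tendsto_nhds_spectralRadius t
  rw [h] at hlim
  have hev : ∀ᶠ n : ℕ in atTop, ‖t ^ n‖ ≤ ε ^ n := by
    filter_upwards [hlim.eventually (gt_mem_nhds (ENNReal.ofReal_pos.2 hε)),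
      eventually_gt_atTop 0] with n hn hn0
    rw [ENNReal.ofReal_lt_ofReal_iff hε] at hn
    have := Real.rpow_le_rpow (by positivity) hn.le (Nat.cast_nonneg n)
    rwa [← Real.rpow_mul (norm_nonneg _), one_div_mul_cancel (by positivity), Real.rpow_one,
      Real.rpow_natCast] at this
  obtain ⟨N, hN⟩ := eventually_atTop.1 hev
  -- Gelfand's formula gives constant 1 beyond `N`; the sum absorbs the finitely many earlier
  -- powers.
  refine ⟨1 + ∑ k ∈ Finset.range N, ‖t ^ k‖ / ε ^ k, by positivity, fun n => ?_⟩
  have hεn : (0 : ℝ) < ε ^ n := by positivity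
  rcases le_or_gt N n with hn | hn
  · refine (hN n hn).trans (le_mul_of_one_le_left hεn.le ?_)
    have : 0 ≤ ∑ k ∈ Finset.range N, ‖t ^ k‖ / ε ^ k := by positivity
    linarith
  · rw [← div_le_iff₀ hεn]
    have : ‖t ^ n‖ / ε ^ n ≤ ∑ k ∈ Finset.range N, ‖t ^ k‖ / ε ^ k :=
      Finset.single_le_sum (f := fun k => ‖t ^ k‖ / ε ^ k) (fun k _ => by positivity)
        (Finset.mem_range.2 hn)
    linarith

theorem powersDecay_iff_spectralRadius_eq_zero [CompleteSpace R] {t : R} :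
    PowersDecay t ↔ spectralRadius ℂ t = 0 := by
  refine ⟨fun h => ?_, powersDecay_of_spectralRadius_eq_zero⟩
  rw [spectralRadius_eq_zero_iff]
  intro z hz
  by_contra hu
  exact hz (h.eq_zero_of_mem_spectrum hu)

theorem PowersDecay.isUnit_sub [CompleteSpace R] {t : R} (h : PowersDecay t) {z : ℂ}
    (hz : z ≠ 0) : IsUnit (t - algebraMap ℂ R z) := by
  rw [← neg_sub]
  exact (spectralRadius_eq_zero_iff.1 (powersDecay_iff_spectralRadius_eq_zero.1 h) z hz).neg

theorem isUnit_one_sub_smul_of_small [CompleteSpace R] (r : R) :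
    ∃ ε : ℝ, 0 < ε ∧ ∀ z : ℂ, ‖z‖ < ε → IsUnit (1 - z • r) := by
  refine ⟨(‖r‖ + 1)⁻¹, by positivity, fun z hz => ?_⟩
  apply isUnit_one_sub_of_norm_lt_one
  rw [norm_smul]
  have h1 : 0 < ‖r‖ + 1 := by positivity
  have h2 : ‖z‖ * (‖r‖ + 1) < 1 := by rwa [← lt_inv_mul_iff₀' h1, mul_one] 
  nlinarith [norm_nonneg z]

namespace IsQuasinilpotentProj

variable {t p : R}

/-- The inverse of `1 + t` on the range of `p`. -/
theorem exists_inverse_one_add [CompleteSpace R] (h : IsQuasinilpotentProj t p) :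
    ∃ g, g * (1 + t) * p = p ∧ p * (1 + t) * g = p := by
  have hu : IsUnit (1 + t * p) := by
    have := h.decay.isUnit_sub (z := -1) (by norm_num)
    simpa [add_comm] using this
  obtain ⟨u, hu⟩ := hu
  have hc : p * (1 + t * p) = (1 + t) * p := by
    rw [mul_add, ← mul_assoc, h.comm, mul_assoc, h.idem]; noncomm_ring
  have hc' : (1 + t * p) * p = (1 + t) * p := by
    rw [add_mul, mul_assoc, h.idem]; noncomm_ring
  have hc'' : p * (1 + t) = (1 + t) * p := by
    rw [mul_add, h.comm]; noncomm_ring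
  refine ⟨↑u⁻¹, ?_, ?_⟩
  · rw [mul_assoc, ← hc', ← hu, ← mul_assoc, u.inv_mul, one_mul]
  · rw [hc'', ← hc, ← hu, mul_assoc, u.mul_inv, mul_one]

/-- `t + p` acts as `t` on the range of `1 - p` and as `1 + t` on that of `p`, so `l` and the
inverse of `1 + t` there glue together. -/
theorem leftInverse_add [CompleteSpace R] (h : IsQuasinilpotentProj t p) {l : R}
    (hl : l * t = 1 - p) : ∃ r, r * (t + p) = 1 := by
  obtain ⟨g, hg, -⟩ := h.exists_inverse_one_add
  refine ⟨l * (1 - p) + g * p, ?_⟩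
  have h1 := h.idem
  have e1 : (1 - p) * (t + p) = t * (1 - p) := by
    simp only [sub_mul, mul_sub, mul_add, one_mul, mul_one, h1, h.comm]; abel
  have e2 : p * (t + p) = (1 + t) * p := by
    rw [mul_add, h1, h.comm]; noncomm_ring
  rw [add_mul, mul_assoc, e1, ← mul_assoc, hl, h.one_sub_mul, mul_assoc, e2, ← mul_assoc, hg]
  noncomm_ring

theorem rightInverse_add [CompleteSpace R] (h : IsQuasinilpotentProj t p) {l : R}
    (hl : t * l = 1 - p) : ∃ r, (t + p) * r = 1 := by
  obtain ⟨g, -, hg⟩ := h.exists_inverse_one_add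
  refine ⟨(1 - p) * l + p * g, ?_⟩
  have h1 := h.idem
  have e1 : (t + p) * (1 - p) = (1 - p) * t := by
    simp only [sub_mul, mul_sub, add_mul, one_mul, mul_one, h1, h.comm]; abel
  have e2 : (t + p) * p = p * (1 + t) := by
    rw [add_mul, h1, mul_add, h.comm]; noncomm_ring
  rw [mul_add, ← mul_assoc, e1, mul_assoc, hl, h.one_sub_mul, ← mul_assoc, e2, hg]
  noncomm_ring

/-- The inverse of `t - z` on the range of `p`, for `z ≠ 0`. -/
theorem exists_inverse_sub [CompleteSpace R] (h : IsQuasinilpotentProj t p) {z : ℂ} (hz : z ≠ 0) :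
    ∃ g, g * p * (t - algebraMap ℂ R z) = p ∧ (t - algebraMap ℂ R z) * p * g = p := by
  obtain ⟨u, hu⟩ := h.decay.isUnit_sub hz
  have hzp := Algebra.commutes z p
  have hc : p * (t * p - algebraMap ℂ R z) = p * (t - algebraMap ℂ R z) := by
    rw [mul_sub, ← mul_assoc, h.comm, mul_assoc, h.idem, mul_sub, h.comm]
  have hc' : (t * p - algebraMap ℂ R z) * p = (t - algebraMap ℂ R z) * p := by
    rw [sub_mul, mul_assoc, h.idem, sub_mul]
  have hc'' : p * (t - algebraMap ℂ R z) = (t - algebraMap ℂ R z) * p := by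
    rw [mul_sub, h.comm, sub_mul, hzp]
  refine ⟨↑u⁻¹, ?_, ?_⟩
  · rw [mul_assoc, hc'', ← hc', ← hu, ← mul_assoc, u.inv_mul, one_mul]
  · rw [← hc'', ← hc, ← hu, mul_assoc, u.mul_inv, mul_one]

theorem one_sub_comm_sub (h : IsQuasinilpotentProj t p) (z : ℂ) :
    (1 - p) * (t - algebraMap ℂ R z) = (t + p - algebraMap ℂ R z) * (1 - p) := by
  have h1 := h.idem
  have h2 := h.comm
  have hzp := Algebra.commutes z p
  simp only [sub_mul, mul_sub, add_mul, one_mul, mul_one, h1, h2, hzp]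
  abel

theorem one_sub_comm_sub' (h : IsQuasinilpotentProj t p) (z : ℂ) :
    (t - algebraMap ℂ R z) * (1 - p) = (1 - p) * (t + p - algebraMap ℂ R z) := by
  have h1 := h.idem
  have h2 := h.comm
  have hzp := Algebra.commutes z p
  simp only [sub_mul, mul_sub, mul_add, one_mul, mul_one, h1, h2, hzp]
  abel

/-- On the range of `p`, `t - z` is invertible for every `z ≠ 0`. On that of `1 - p` it agrees with
`t + p - z`, and `r * (t + p - z) = 1 - z • r` is a unit for small `z`. -/
theorem leftInverse_sub_of_small [CompleteSpace R] (h : IsQuasinilpotentProj t p) {r : R}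
    (hr : r * (t + p) = 1) : ∃ ε : ℝ, 0 < ε ∧ ∀ z : ℂ, z ≠ 0 → ‖z‖ < ε →
      ∃ s, s * (t - algebraMap ℂ R z) = 1 := by
  obtain ⟨ε, hε, hu⟩ := isUnit_one_sub_smul_of_small r
  refine ⟨ε, hε, fun z hz hzε => ?_⟩
  obtain ⟨u, hu⟩ := hu z hzε
  obtain ⟨g, hg, -⟩ := h.exists_inverse_sub hz
  refine ⟨↑u⁻¹ * r * (1 - p) + g * p, ?_⟩
  have e : r * (t + p - algebraMap ℂ R z) = u := by
    rw [hu, mul_sub, hr, ← Algebra.commutes, Algebra.smul_def]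
  rw [add_mul, mul_assoc, h.one_sub_comm_sub, ← mul_assoc, mul_assoc (↑u⁻¹ : R), e, u.inv_mul, hg]
  noncomm_ring

theorem rightInverse_sub_of_small [CompleteSpace R] (h : IsQuasinilpotentProj t p) {r : R}
    (hr : (t + p) * r = 1) : ∃ ε : ℝ, 0 < ε ∧ ∀ z : ℂ, z ≠ 0 → ‖z‖ < ε →
      ∃ s, (t - algebraMap ℂ R z) * s = 1 := by
  obtain ⟨ε, hε, hu⟩ := isUnit_one_sub_smul_of_small r
  refine ⟨ε, hε, fun z hz hzε => ?_⟩
  obtain ⟨u, hu⟩ := hu z hzε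
  obtain ⟨g, -, hg⟩ := h.exists_inverse_sub hz
  refine ⟨(1 - p) * (r * ↑u⁻¹) + p * g, ?_⟩
  have e : (t + p - algebraMap ℂ R z) * r = u := by
    rw [hu, sub_mul, hr, Algebra.smul_def]
  rw [mul_add, ← mul_assoc, h.one_sub_comm_sub', mul_assoc, ← mul_assoc _ r, e, u.mul_inv,
    ← mul_assoc, hg]
  noncomm_ring

end IsQuasinilpotentProj

end BanachAlgebra

/-! ### The Riesz projection through moments of the resolvent -/

section Riesz

variable {R : Type*} [NormedRing R] [NormedAlgebra ℂ R]

theorem mul_resolvent_eq {a : R} {z : ℂ} (hz : z ∈ resolventSet ℂ a) :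
    a * resolvent a z = z • resolvent a z - 1 ∧ resolvent a z * a = z • resolvent a z - 1 := by
  have h1 : (algebraMap ℂ R z - a) * resolvent a z = 1 := Ring.mul_inverse_cancel _ hz
  have h2 : resolvent a z * (algebraMap ℂ R z - a) = 1 := Ring.inverse_mul_cancel _ hz
  rw [sub_mul, ← Algebra.smul_def] at h1
  rw [mul_sub, ← Algebra.commutes, ← Algebra.smul_def] at h2
  exact ⟨by rw [← h1]; abel, by rw [← h2]; abel⟩

variable [CompleteSpace R]

/-- The `n`-th moment of the resolvent of `a` over the circle of radius `r` around `0`. -/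
noncomputable def resolventMoment (a : R) (r : ℝ) (n : ℤ) : R :=
  (2 * Real.pi * Complex.I : ℂ)⁻¹ • ∮ z in C(0, r), z ^ n • resolvent a z

variable {a : R} {ε : ℝ}

theorem differentiableAt_zpow_smul_resolvent (n : ℤ) {z : ℂ} (hz : z ≠ 0)
    (h : z ∈ resolventSet ℂ a) : DifferentiableAt ℂ (fun z => z ^ n • resolvent a z) z :=
  (differentiableAt_zpow.2 (Or.inl hz)).smul
    (spectrum.hasDerivAt_resolvent_const_left h).differentiableAt

theorem mem_sphere_zero_bounds {r : ℝ} (hr : 0 < r) (hrε : r < ε) {z : ℂ}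
    (hz : z ∈ sphere (0 : ℂ) r) : z ≠ 0 ∧ ‖z‖ < ε := by
  rw [mem_sphere_zero_iff_norm] at hz
  exact ⟨norm_pos_iff.1 (hz ▸ hr), hz ▸ hrε⟩

theorem continuousOn_sphere_zpow_smul_resolvent
    (h : ∀ z : ℂ, z ≠ 0 → ‖z‖ < ε → z ∈ resolventSet ℂ a) {r : ℝ} (hr : 0 < r) (hrε : r < ε)
    (n : ℤ) : ContinuousOn (fun z => z ^ n • resolvent a z) (sphere (0 : ℂ) r) := fun z hz => by
  obtain ⟨h0, h1⟩ := mem_sphere_zero_bounds hr hrε hz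
  exact (differentiableAt_zpow_smul_resolvent n h0 (h z h0 h1)).continuousAt.continuousWithinAt

/-- Cauchy's theorem on the annulus. Freedom in the radius is what later yields both idempotence and
decay. -/
theorem resolventMoment_eq_of_le (h : ∀ z : ℂ, z ≠ 0 → ‖z‖ < ε → z ∈ resolventSet ℂ a)
    {r s : ℝ} (hr : 0 < r) (hrs : r ≤ s) (hs : s < ε) (n : ℤ) :
    resolventMoment a s n = resolventMoment a r n := by
  unfold resolventMoment
  congr 1
  have hd : ∀ z ∈ closedBall (0 : ℂ) s \ ball 0 r,
      DifferentiableAt ℂ (fun z => z ^ n • resolvent a z) z := by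
    rintro z ⟨hz1, hz2⟩
    rw [mem_closedBall_zero_iff] at hz1
    rw [mem_ball_zero_iff, not_lt] at hz2
    have h0 : z ≠ 0 := norm_pos_iff.1 (hr.trans_le hz2)
    exact differentiableAt_zpow_smul_resolvent n h0 (h z h0 (hz1.trans_lt hs))
  refine Complex.circleIntegral_eq_of_differentiable_on_annulus_off_countable hr hrs
    Set.countable_empty (fun z hz => (hd z hz).continuousAt.continuousWithinAt) ?_
  rintro z ⟨⟨hz1, hz2⟩, -⟩
  exact hd z ⟨ball_subset_closedBall hz1, fun hz => hz2 (ball_subset_closedBall hz)⟩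

theorem resolventMoment_eq (h : ∀ z : ℂ, z ≠ 0 → ‖z‖ < ε → z ∈ resolventSet ℂ a)
    {r s : ℝ} (hr : 0 < r) (hrε : r < ε) (hs : 0 < s) (hsε : s < ε) (n : ℤ) :
    resolventMoment a s n = resolventMoment a r n := by
  rcases le_total r s with hrs | hrs
  · exact resolventMoment_eq_of_le h hr hrs hsε n
  · exact (resolventMoment_eq_of_le h hs hrs hrε n).symm

theorem exists_norm_resolventMoment_le (h : ∀ z : ℂ, z ≠ 0 → ‖z‖ < ε → z ∈ resolventSet ℂ a)
    {r : ℝ} (hr : 0 < r) (hrε : r < ε) :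
    ∃ K : ℝ, 0 ≤ K ∧ ∀ n : ℤ, ‖resolventMoment a r n‖ ≤ K * r ^ n := by
  have hc := continuousOn_sphere_zpow_smul_resolvent h hr hrε 0
  simp only [zpow_zero, one_smul] at hc
  obtain ⟨K, hK⟩ := (isCompact_sphere (0 : ℂ) r).exists_bound_of_continuousOn hc
  have hK0 : 0 ≤ K := (norm_nonneg _).trans (hK (r : ℂ) (by simp [hr.le]))
  refine ⟨r * K, by positivity, fun n => ?_⟩
  have := circleIntegral.norm_two_pi_i_inv_smul_integral_le_of_norm_le_const (c := 0)
    (f := fun z => z ^ n • resolvent a z) (C := r ^ n * K) hr.le (fun z hz => by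
      rw [norm_smul, norm_zpow, mem_sphere_zero_iff_norm.1 hz]
      exact mul_le_mul_of_nonneg_left (hK z hz) (by positivity))
  unfold resolventMoment
  linarith

theorem clm_circleIntegral {E F : Type*} [NormedAddCommGroup E] [NormedSpace ℂ E] [CompleteSpace E]
    [NormedAddCommGroup F] [NormedSpace ℂ F] [CompleteSpace F] (L : E →L[ℂ] F) {f : ℂ → E} {c : ℂ}
    {r : ℝ} (hf : CircleIntegrable f c r) :
    (∮ z in C(c, r), L (f z)) = L (∮ z in C(c, r), f z) := by
  unfold circleIntegral
  rw [← L.intervalIntegral_comp_comm ((circleIntegrable_iff r).1 hf)]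
  simp

theorem circleIntegral_zpow_smul_one {r : ℝ} (hr : 0 < r) (n : ℤ) :
    (2 * Real.pi * Complex.I : ℂ)⁻¹ • (∮ z in C(0, r), z ^ n • (1 : R)) =
      if n = -1 then 1 else 0 := by
  rw [circleIntegral.integral_smul_const]
  split_ifs with hn
  · have := circleIntegral.integral_sub_center_inv 0 hr.ne'
    simp only [sub_zero] at this
    simp only [hn, zpow_neg_one, this, smul_smul]
    rw [inv_mul_cancel₀ Complex.two_pi_I_ne_zero, one_smul]
  · have := circleIntegral.integral_sub_zpow_of_ne hn 0 0 r
    simp only [sub_zero] at this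
    simp [this]

/-- Integrate `a * resolvent a z = z • resolvent a z - 1`; only `n = -1` leaves a residue from the
constant term. `L` stands for left or right multiplication by `a`. -/
theorem resolventMoment_succ_aux (h : ∀ z : ℂ, z ≠ 0 → ‖z‖ < ε → z ∈ resolventSet ℂ a)
    {r : ℝ} (hr : 0 < r) (hrε : r < ε) (n : ℤ) (L : R →L[ℂ] R)
    (hL : ∀ z ∈ resolventSet ℂ a, L (resolvent a z) = z • resolvent a z - 1) :
    L (resolventMoment a r n) =
      resolventMoment a r (n + 1) - if n = -1 then 1 else 0 := by
  have hint : ∀ m : ℤ, CircleIntegrable (fun z => z ^ m • resolvent a z) 0 r := fun m =>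
    (continuousOn_sphere_zpow_smul_resolvent h hr hrε m).circleIntegrable hr.le
  have hint1 : CircleIntegrable (fun z : ℂ => z ^ n • (1 : R)) 0 r := by
    refine ContinuousOn.circleIntegrable hr.le fun z hz => ?_
    exact ((continuousAt_zpow₀ z n (Or.inl (mem_sphere_zero_bounds hr hrε hz).1)).smul
      continuousAt_const).continuousWithinAt
  unfold resolventMoment
  rw [← circleIntegral_zpow_smul_one hr n, ← smul_sub, map_smul, ← clm_circleIntegral L (hint n),
    ← circleIntegral.integral_sub (hint _) hint1]
  congr 1
  refine circleIntegral.integral_congr hr.le fun z hz => ?_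
  obtain ⟨h0, h1⟩ := mem_sphere_zero_bounds hr hrε hz
  simp only [map_smul, hL z (h z h0 h1), smul_sub, smul_smul, zpow_add_one₀ h0]

theorem mul_resolventMoment (h : ∀ z : ℂ, z ≠ 0 → ‖z‖ < ε → z ∈ resolventSet ℂ a)
    {r : ℝ} (hr : 0 < r) (hrε : r < ε) (n : ℤ) :
    a * resolventMoment a r n = resolventMoment a r (n + 1) - if n = -1 then 1 else 0 :=
  resolventMoment_succ_aux h hr hrε n (ContinuousLinearMap.mul ℂ R a)
    fun _ hz => (mul_resolvent_eq hz).1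

theorem resolventMoment_mul (h : ∀ z : ℂ, z ≠ 0 → ‖z‖ < ε → z ∈ resolventSet ℂ a)
    {r : ℝ} (hr : 0 < r) (hrε : r < ε) (n : ℤ) :
    resolventMoment a r n * a = resolventMoment a r (n + 1) - if n = -1 then 1 else 0 :=
  resolventMoment_succ_aux h hr hrε n ((ContinuousLinearMap.mul ℂ R).flip a)
    fun _ hz => (mul_resolvent_eq hz).2

theorem pow_mul_resolventMoment_zero (h : ∀ z : ℂ, z ≠ 0 → ‖z‖ < ε → z ∈ resolventSet ℂ a)
    {r : ℝ} (hr : 0 < r) (hrε : r < ε) (n : ℕ) :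
    a ^ n * resolventMoment a r 0 = resolventMoment a r n := by
  induction n with
  | zero => simp
  | succ n ih =>
    rw [pow_succ', mul_assoc, ih, mul_resolventMoment h hr hrε, if_neg (by lia)]
    simp

theorem pow_mul_resolventMoment_neg (h : ∀ z : ℂ, z ≠ 0 → ‖z‖ < ε → z ∈ resolventSet ℂ a)
    {r : ℝ} (hr : 0 < r) (hrε : r < ε) (n : ℕ) :
    a ^ (n + 1) * resolventMoment a r (-(n + 1 : ℤ)) = resolventMoment a r 0 - 1 := by
  induction n with
  | zero => simp [mul_resolventMoment h hr hrε]
  | succ n ih =>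
    rw [pow_succ, mul_assoc, mul_resolventMoment h hr hrε, if_neg (by push_cast; lia), sub_zero,
      ← ih]
    congr 2

/-- With `p` the zeroth moment, `p * (p - 1)` equals the moment of order `n + 1` times that of order
`-(n + 1)`, for every `n`. Estimating the first on radius `r / 2` and the second on radius `r` gives
a bound of order `2 ^ (-(n + 1))`. -/
theorem isIdempotentElem_resolventMoment_zero
    (h : ∀ z : ℂ, z ≠ 0 → ‖z‖ < ε → z ∈ resolventSet ℂ a) {r : ℝ} (hr : 0 < r) (hrε : r < ε)
    (hcomm : Commute a (resolventMoment a r 0)) :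
    resolventMoment a r 0 * resolventMoment a r 0 = resolventMoment a r 0 := by
  have hr2 : 0 < r / 2 := by positivity
  have hr2ε : r / 2 < ε := by linarith
  obtain ⟨K, hK, hKb⟩ := exists_norm_resolventMoment_le h hr hrε
  obtain ⟨K', hK', hKb'⟩ := exists_norm_resolventMoment_le h hr2 hr2ε
  have key : ∀ n : ℕ, ‖resolventMoment a r 0 * (resolventMoment a r 0 - 1)‖ ≤
      K' * K * (1 / 2) ^ (n + 1) := by
    intro n
    rw [← pow_mul_resolventMoment_neg h hr hrε n, ← mul_assoc, ← (hcomm.pow_left (n + 1)).eq,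
      pow_mul_resolventMoment_zero h hr hrε]
    refine (norm_mul_le _ _).trans ?_
    have h1 := hKb' ((n + 1 : ℕ) : ℤ)
    rw [resolventMoment_eq h hr hrε hr2 hr2ε] at h1
    refine (mul_le_mul h1 (hKb _) (norm_nonneg _) (by positivity)).trans (le_of_eq ?_)
    have hz : (r : ℝ) ^ (-(n + 1 : ℤ)) = (r ^ (n + 1))⁻¹ := by
      rw [zpow_neg]; norm_cast
    rw [hz, zpow_natCast, div_pow, one_div, inv_pow]
    field_simp
  have hlim : Tendsto (fun n : ℕ => K' * K * (1 / 2 : ℝ) ^ (n + 1)) atTop (𝓝 0) := by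
    have := (tendsto_pow_atTop_nhds_zero_of_lt_one (r := (1 / 2 : ℝ)) (by norm_num)
      (by norm_num)).comp (tendsto_add_atTop_nat 1)
    simpa using! this.const_mul (K' * K)
  have h0 := norm_le_zero_iff.1 (ge_of_tendsto' hlim key)
  rwa [mul_sub, mul_one, sub_eq_zero] at h0

/-- The Riesz projection at an isolated point: if `a - z` is invertible for all small `z ≠ 0`, then
`a` is the direct sum of an invertible and a quasi-nilpotent element. -/
theorem exists_isQuasinilpotentProj_isUnit {a : R} {ε : ℝ} (hε : 0 < ε)
    (h : ∀ z : ℂ, z ≠ 0 → ‖z‖ < ε → IsUnit (a - algebraMap ℂ R z)) :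
    ∃ p, IsQuasinilpotentProj a p ∧ (∃ r, r * (a + p) = 1) ∧ ∃ r, (a + p) * r = 1 := by
  have h : ∀ z : ℂ, z ≠ 0 → ‖z‖ < ε → z ∈ resolventSet ℂ a := fun z h0 h1 => by
    have := (h z h0 h1).neg
    rwa [neg_sub] at this
  set r := ε / 2 with hr_def
  have hr : 0 < r := by positivity
  have hrε : r < ε := by linarith
  have e0 := mul_resolventMoment h hr hrε 0
  have e0' := resolventMoment_mul h hr hrε 0
  have hcomm : Commute a (resolventMoment a r 0) := e0.trans e0'.symm
  have hidem := isIdempotentElem_resolventMoment_zero h hr hrε hcomm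
  have hp : IsQuasinilpotentProj a (resolventMoment a r 0) := by
    refine ⟨hidem, hcomm.symm, fun δ hδ => ?_⟩
    have hs : 0 < min δ r := lt_min hδ hr
    have hsε : min δ r < ε := (min_le_right _ _).trans_lt hrε
    obtain ⟨K, hK, hKb⟩ := exists_norm_resolventMoment_le h hs hsε
    refine ⟨K + ‖(1 : R)‖, by positivity, fun n => ?_⟩
    rcases n with _ | n
    · simp [hK]
    · have hpow : (a * resolventMoment a r 0) ^ (n + 1) =
          resolventMoment a (min δ r) (n + 1 : ℕ) := by
        rw [hcomm.mul_pow, IsIdempotentElem.pow_succ_eq n hidem,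
          pow_mul_resolventMoment_zero h hr hrε, resolventMoment_eq h hr hrε hs hsε]
      rw [hpow]
      have h1 := hKb (n + 1 : ℕ)
      rw [zpow_natCast] at h1
      refine h1.trans ?_
      gcongr
      · linarith [norm_nonneg (1 : R)]
      · exact min_le_left _ _
  -- Since `a` times the moment of order `-1` is `p - 1`, minus that moment inverts `a` on the range
  -- of `1 - p`.
  refine ⟨_, hp, hp.leftInverse_add (l := -resolventMoment a r (-1)) ?_,
    hp.rightInverse_add (l := -resolventMoment a r (-1)) ?_⟩
  · rw [neg_mul, resolventMoment_mul h hr hrε]; simp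
  · rw [mul_neg, mul_resolventMoment h hr hrε]; simp

end Riesz

/-! ### Invariant decompositions versus commuting idempotents -/

section Decomposition

variable {X : Type*} [NormedAddCommGroup X] [NormedSpace ℂ X] [CompleteSpace X] {T : X →L[ℂ] X}

theorem exists_isQuasinilpotentProj_of_isCompl {X₁ X₂ : Submodule ℂ X} (h₁ : ∀ x ∈ X₁, T x ∈ X₁)
    (h₂ : ∀ x ∈ X₂, T x ∈ X₂) (hc₁ : IsClosed (X₁ : Set X)) (hc₂ : IsClosed (X₂ : Set X))
    (hc : IsCompl X₁ X₂) (hq : IsQuasinilpotent (T.restrict h₂)) :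
    ∃ P : X →L[ℂ] X, IsQuasinilpotentProj T P ∧
      (IsLeftInvertible (T.restrict h₁) → ∃ l, l * T = 1 - P) ∧
      (IsRightInvertible (T.restrict h₁) → ∃ l, T * l = 1 - P) := by
  have ht := Submodule.IsCompl.isTopCompl_of_isClosed hc hc₁ hc₂
  have := hc₁.completeSpace_coe
  have := hc₂.completeSpace_coe
  obtain ⟨π₁, hπ₁⟩ : ∃ f, f = X₁.projectionOntoL X₂ ht := ⟨_, rfl⟩
  obtain ⟨π₂, hπ₂⟩ : ∃ f, f = X₂.projectionOntoL X₁ ht.symm := ⟨_, rfl⟩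
  have a11 : ∀ x : X₁, π₁ x = x := fun x => hπ₁ ▸ Submodule.projectionOntoL_apply_left ht x
  have a12 : ∀ x : X₂, π₁ x = 0 := fun x => hπ₁ ▸ Submodule.projectionOntoL_apply_right ht x
  have a22 : ∀ x : X₂, π₂ x = x := fun x => hπ₂ ▸ Submodule.projectionOntoL_apply_left ht.symm x
  have a21 : ∀ x : X₁, π₂ x = 0 := fun x => hπ₂ ▸ Submodule.projectionOntoL_apply_right ht.symm x
  have hsum : ∀ x, (π₁ x : X) + π₂ x = x := fun x => by
    rw [hπ₁, hπ₂]
    exact Submodule.projectionL_add_projectionL_eq_self ht x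
  have hπ₁T : ∀ x, π₁ (T x) = T.restrict h₁ (π₁ x) := fun x => by
    conv_lhs => rw [← hsum x, map_add, map_add]
    have e1 := a11 (T.restrict h₁ (π₁ x))
    have e2 := a12 (T.restrict h₂ (π₂ x))
    rw [ContinuousLinearMap.coe_restrict_apply] at e1 e2
    rw [e1, e2, add_zero]
  have hπ₂T : ∀ x, π₂ (T x) = T.restrict h₂ (π₂ x) := fun x => by
    conv_lhs => rw [← hsum x, map_add, map_add]
    have e1 := a21 (T.restrict h₁ (π₁ x))
    have e2 := a22 (T.restrict h₂ (π₂ x))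
    rw [ContinuousLinearMap.coe_restrict_apply] at e1 e2
    rw [e1, e2, zero_add]
  have hone : ∀ x, (1 - X₂.subtypeL ∘L π₂ : X →L[ℂ] X) x = π₁ x := fun x => by
    simpa using sub_eq_of_eq_add (hsum x).symm
  refine ⟨X₂.subtypeL ∘L π₂, ⟨?_, ?_, ?_⟩, ?_, ?_⟩
  · ext x; simp [a22]
  · ext x; simp [hπ₂T]
  · have hpow : ∀ (n : ℕ) (x : X), ((T * (X₂.subtypeL ∘L π₂)) ^ (n + 1)) x =
        ((T.restrict h₂ ^ (n + 1)) (π₂ x) : X₂) := by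
      intro n
      induction n with
      | zero => intro x; simp
      | succ n ih =>
        intro x
        rw [pow_succ', mul_apply_eq_comp, ih, pow_succ' (T.restrict h₂) (n + 1)]
        change T (π₂ ((T.restrict h₂ ^ (n + 1)) (π₂ x) : X₂)) =
          T.restrict h₂ ((T.restrict h₂ ^ (n + 1)) (π₂ x))
        rw [a22]
        rfl
    refine powersDecay_of_le (powersDecay_of_spectralRadius_eq_zero hq) (norm_nonneg π₂)
      fun n => ContinuousLinearMap.opNorm_le_bound _ (by positivity) fun x => ?_
    rw [hpow, mul_comm ‖π₂‖, mul_assoc]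
    exact (T.restrict h₂ ^ (n + 1)).le_opNorm_of_le (π₂.le_opNorm x)
  · rintro ⟨S, hS⟩
    refine ⟨X₁.subtypeL ∘L S ∘L π₁, ContinuousLinearMap.ext fun x => ?_⟩
    rw [hone]
    have := DFunLike.congr_fun hS (π₁ x)
    simp only [ContinuousLinearMap.comp_apply, ContinuousLinearMap.id_apply] at this
    simp [hπ₁T, this]
  · rintro ⟨S, hS⟩
    refine ⟨X₁.subtypeL ∘L S ∘L π₁, ContinuousLinearMap.ext fun x => ?_⟩
    rw [hone]
    have := DFunLike.congr_fun hS (π₁ x)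
    simp only [ContinuousLinearMap.comp_apply, ContinuousLinearMap.id_apply] at this
    exact congrArg Subtype.val this

theorem exists_isCompl_of_isQuasinilpotentProj {P : X →L[ℂ] X} (h : IsQuasinilpotentProj T P) :
    ∃ (X₁ X₂ : Submodule ℂ X) (h₁ : ∀ x ∈ X₁, T x ∈ X₁) (h₂ : ∀ x ∈ X₂, T x ∈ X₂),
      IsClosed (X₁ : Set X) ∧ IsClosed (X₂ : Set X) ∧ IsCompl X₁ X₂ ∧
        ((∃ l, l * (T + P) = 1) → IsLeftInvertible (T.restrict h₁)) ∧
        ((∃ l, (T + P) * l = 1) → IsRightInvertible (T.restrict h₁)) ∧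
        IsQuasinilpotent (T.restrict h₂) := by
  have hidem : ∀ x, P (P x) = P x := fun x => DFunLike.congr_fun h.idem x
  have hcomm : ∀ x, P (T x) = T (P x) := fun x => DFunLike.congr_fun h.comm x
  obtain ⟨X₁, hc1, m1⟩ : ∃ X₁ : Submodule ℂ X, IsClosed (X₁ : Set X) ∧ ∀ x, x ∈ X₁ ↔ P x = 0 :=
    ⟨P.ker, P.isClosed_ker, fun x => Iff.rfl⟩
  obtain ⟨X₂, hc2, m2⟩ : ∃ X₂ : Submodule ℂ X, IsClosed (X₂ : Set X) ∧ ∀ x, x ∈ X₂ ↔ P x = x :=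
    ⟨(1 - P).ker, (1 - P).isClosed_ker, fun x => by
      rw [LinearMap.mem_ker]
      simp [sub_eq_zero, eq_comm (a := x)]⟩
  have hi1 : ∀ x ∈ X₁, T x ∈ X₁ :=
    fun x hx => by
      rw [m1] at hx ⊢
      rw [hcomm, hx, map_zero]
  have hi2 : ∀ x ∈ X₂,
      T x ∈ X₂ := fun x hx => by
    rw [m2] at hx ⊢
    rw [hcomm, hx]
  have hmem : ∀ l : X →L[ℂ] X, P * l = 0 → ∀ x, l x ∈ X₁ :=
    fun l hl x => (m1 _).2 (DFunLike.congr_fun hl x)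
  refine ⟨_, _, hi1, hi2, hc1, hc2, ?_, ?_, ?_, ?_⟩
  · refine ⟨Submodule.disjoint_def.2 fun x hx1 hx2 => ?_,
      codisjoint_iff.2 (eq_top_iff.2 fun x _ => ?_)⟩
    · rw [m1] at hx1
      rw [m2] at hx2
      rw [← hx2, hx1]
    · refine Submodule.mem_sup.2 ⟨x - P x, ?_, P x, ?_, by simp⟩
      · rw [m1]; simp [hidem]
      · rw [m2]; exact hidem x
  · rintro ⟨r, hr⟩
    obtain ⟨l, hl, -, hPl⟩ := h.exists_leftInverse hr
    refine ⟨l.restrict fun x _ => hmem l hPl x, ContinuousLinearMap.ext fun x => Subtype.ext ?_⟩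
    have := DFunLike.congr_fun hl (x : X)
    have hx := (m1 _).1 x.2
    simpa [hx] using this
  · rintro ⟨r, hr⟩
    obtain ⟨l, hl, -, hPl⟩ := h.exists_rightInverse hr
    refine ⟨l.restrict fun x _ => hmem l hPl x, ContinuousLinearMap.ext fun x => Subtype.ext ?_⟩
    have := DFunLike.congr_fun hl (x : X)
    have hx := (m1 _).1 x.2
    simpa [hx] using this
  · have := hc2.completeSpace_coe
    refine powersDecay_iff_spectralRadius_eq_zero.1 ?_
    have hpow : ∀ (n : ℕ) (x : X₂),
        ((T * P) ^ n) (x : X) = ((T.restrict hi2 ^ n) x : X₂) := by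
      intro n
      induction n with
      | zero => intro x; simp
      | succ n ih =>
        intro x
        rw [pow_succ, pow_succ (T.restrict hi2)]
        change ((T * P) ^ n) (T (P x)) = ((T.restrict hi2 ^ n) (T.restrict hi2 x) : X₂)
        rw [← ih, (m2 _).1 x.2]
        rfl
    refine powersDecay_of_le h.decay zero_le_one fun n =>
      ContinuousLinearMap.opNorm_le_bound _ (by positivity) fun x => ?_
    rw [one_mul, Submodule.coe_norm, ← hpow]
    exact ContinuousLinearMap.le_opNorm _ _

theorem isLeftGenDrazin_iff : IsLeftGenDrazin T ↔
    ∃ P, IsQuasinilpotentProj T P ∧ ∃ r, r * (T + P) = 1 := by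
  constructor
  · rintro ⟨X₁, X₂, h₁, h₂, hc₁, hc₂, hc, hl, hq⟩
    obtain ⟨P, hP, hL, -⟩ := exists_isQuasinilpotentProj_of_isCompl h₁ h₂ hc₁ hc₂ hc hq
    obtain ⟨l, hl⟩ := hL hl
    exact ⟨P, hP, hP.leftInverse_add hl⟩
  · rintro ⟨P, hP, hr⟩
    obtain ⟨X₁, X₂, h₁, h₂, hc₁, hc₂, hc, hL, -, hq⟩ := exists_isCompl_of_isQuasinilpotentProj hP
    exact ⟨X₁, X₂, h₁, h₂, hc₁, hc₂, hc, hL hr, hq⟩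

theorem isRightGenDrazin_iff : IsRightGenDrazin T ↔
    ∃ P, IsQuasinilpotentProj T P ∧ ∃ r, (T + P) * r = 1 := by
  constructor
  · rintro ⟨X₁, X₂, h₁, h₂, hc₁, hc₂, hc, hl, hq⟩
    obtain ⟨P, hP, -, hR⟩ := exists_isQuasinilpotentProj_of_isCompl h₁ h₂ hc₁ hc₂ hc hq
    obtain ⟨l, hl⟩ := hR hl
    exact ⟨P, hP, hP.rightInverse_add hl⟩
  · rintro ⟨P, hP, hr⟩
    obtain ⟨X₁, X₂, h₁, h₂, hc₁, hc₂, hc, -, hR, hq⟩ := exists_isCompl_of_isQuasinilpotentProj hP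
    exact ⟨X₁, X₂, h₁, h₂, hc₁, hc₂, hc, hR hr, hq⟩

end Decomposition

/-! ### One-sided inverses become two-sided under the SVEP -/

section SVEP

variable {X : Type*} [NormedAddCommGroup X] [NormedSpace ℂ X] {T : X →L[ℂ] X}

theorem sub_algebraMap_apply (z : ℂ) (x : X) :
    (T - algebraMap ℂ (X →L[ℂ] X) z) x = T x - z • x := by
  simp [Algebra.algebraMap_eq_smul_one]

/-- Under the SVEP, a right invertible translate of `T` is injective. -/
theorem HasSVEP.eq_zero_of_rightInverse [CompleteSpace X] (hT : HasSVEP T) {z : ℂ} {S : X →L[ℂ] X}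
    (hS : ∀ x, T (S x) - z • S x = x) {x : X} (hx : T x = z • x) : x = 0 := by
  obtain ⟨ε, hε, hu⟩ := isUnit_one_sub_smul_of_small S
  have hu' : ∀ w ∈ ball z ε, IsUnit (1 - (w - z) • S) := fun w hw =>
    hu _ (by rwa [mem_ball, dist_eq_norm] at hw)
  -- Because `T - w = (T - z)(1 - (w - z) S)`, this function is an analytic solution of `(T - w)
  -- f(w) = 0` with `f(z) = x`.
  have hd : DifferentiableOn ℂ (fun w => Ring.inverse (1 - (w - z) • S) x) (ball z ε) := by
    intro w hw
    have h1 : DifferentiableAt ℂ (fun w : ℂ => 1 - (w - z) • S) w := by fun_prop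
    have h2 : DifferentiableAt ℂ (fun w : ℂ => Ring.inverse (1 - (w - z) • S)) w :=
      DifferentiableAt.comp (g := Ring.inverse) w (differentiableAt_inverse (hu' w hw)) h1
    exact (h2.clm_apply (differentiableAt_const x)).differentiableWithinAt
  have key := hT (ball z ε) _ isOpen_ball (hd.analyticOnNhd isOpen_ball) (fun w hw => by
    have e : ∀ y, (T - w • ContinuousLinearMap.id ℂ X) y =
        T ((1 - (w - z) • S) y) - z • (1 - (w - z) • S) y := fun y => by
      have h1 : T (S y) = y + z • S y := sub_eq_iff_eq_add.1 (hS y)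
      simp only [sub_apply, smul_apply,
        ContinuousLinearMap.id_apply, one_apply_eq_self, map_sub, map_smul, h1]
      module
    rw [e, ← mul_apply_eq_comp _ (Ring.inverse _), Ring.mul_inverse_cancel _ (hu' w hw),
      one_apply_eq_self, hx, sub_self])
    z (mem_ball_self hε)
  simpa using key

theorem HasSVEP.isUnit_of_rightInverse [CompleteSpace X] (hT : HasSVEP T) {z : ℂ} {S : X →L[ℂ] X}
    (hS : (T - algebraMap ℂ (X →L[ℂ] X) z) * S = 1) :
    IsUnit (T - algebraMap ℂ (X →L[ℂ] X) z) := by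
  have hS' : ∀ x, T (S x) - z • S x = x := fun x => by
    rw [← sub_algebraMap_apply]
    exact DFunLike.congr_fun hS x
  refine ⟨⟨_, S, hS, ContinuousLinearMap.ext fun x => ?_⟩, rfl⟩
  refine sub_eq_zero.1 (hT.eq_zero_of_rightInverse hS' ?_)
  rw [← sub_eq_zero, ← sub_algebraMap_apply, map_sub, ← mul_apply_eq_comp, ← mul_assoc, hS]
  simp

theorem isUnit_of_leftInverse_of_adj_hasSVEP (hT : HasSVEP (adj T)) {z : ℂ} {S : X →L[ℂ] X}
    (hS : S * (T - algebraMap ℂ (X →L[ℂ] X) z) = 1) :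
    IsUnit (T - algebraMap ℂ (X →L[ℂ] X) z) := by
  set U := T - algebraMap ℂ (X →L[ℂ] X) z with hU
  have hSU : ∀ x, S (U x) = x := fun x => DFunLike.congr_fun hS x
  have hadj : ∀ (φ : StrongDual ℂ X) (x : X), adj T φ x = φ (U x) + z • φ x := fun φ x => by
    simp [adj, hU, Algebra.algebraMap_eq_smul_one]
  have hadjS : ∀ (φ : StrongDual ℂ X) (x : X), adj S φ x = φ (S x) := fun _ _ => rfl
  refine ⟨⟨U, S, ContinuousLinearMap.ext fun x => ?_, hS⟩, rfl⟩
  refine (SeparatingDual.eq_iff_forall_dual_eq (R := ℂ)).2 fun φ => ?_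
  -- `adj S` is a right inverse of `adj T - z`, and `φ ∘ (U S - 1)` lies in its kernel because `S U
  -- = 1`.
  have h0 := hT.eq_zero_of_rightInverse (z := z) (S := adj S) (fun ψ => by
      ext y
      rw [sub_apply, smul_apply, hadj, hadjS, hadjS, hSU]
      simp) (x := φ ∘L (U * S - 1)) (by
    ext y
    rw [hadj]
    simp [hSU])
  have := DFunLike.congr_fun h0 x
  simpa [sub_eq_zero] using this

end SVEP

/-! ### Operator equations with a quasi-nilpotent coefficient -/

section Intertwining

variable {E F : Type*} [NormedAddCommGroup E] [NormedSpace ℂ E]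
  [NormedAddCommGroup F] [NormedSpace ℂ F]

/-- Decay faster than any geometric rate absorbs the growth of `‖s ^ n‖`, at most geometric. -/
theorem PowersDecay.exists_norm_pow_mul_norm_pow_le {R S : Type*} [NormedRing R] [NormedRing S]
    {t : R} (h : PowersDecay t) (s : S) {ε : ℝ} (hε : 0 < ε) :
    ∃ C : ℝ, 0 ≤ C ∧ ∀ n : ℕ, ‖t ^ n‖ * ‖s ^ n‖ ≤ C * ε ^ n := by
  have hs : 0 < ‖s‖ + 1 := by positivity
  obtain ⟨C, hC, hb⟩ := h (ε / (‖s‖ + 1)) (by positivity)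
  have hsn : ∀ n : ℕ, ‖s ^ n‖ ≤ (‖(1 : S)‖ + 1) * (‖s‖ + 1) ^ n := fun n => by
    rcases n with _ | n
    · simp
    · calc ‖s ^ (n + 1)‖ ≤ ‖s‖ ^ (n + 1) := norm_pow_le' s n.succ_pos
        _ ≤ 1 * (‖s‖ + 1) ^ (n + 1) := by rw [one_mul]; gcongr; linarith
        _ ≤ _ := by gcongr; linarith [norm_nonneg (1 : S)]
  refine ⟨C * (‖(1 : S)‖ + 1), by positivity, fun n => ?_⟩
  calc ‖t ^ n‖ * ‖s ^ n‖
      ≤ (C * (ε / (‖s‖ + 1)) ^ n) * ((‖(1 : S)‖ + 1) * (‖s‖ + 1) ^ n) :=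
        mul_le_mul (hb n) (hsn n) (norm_nonneg _) (by positivity)
    _ = C * (‖(1 : S)‖ + 1) * ε ^ n := by
        rw [div_pow]; field_simp

/-- The operator `W ↦ W - V W K` is bijective as soon as `V` or `K` is quasi-nilpotent. -/
theorem bijective_sub_comp_comp [CompleteSpace F] {V : F →L[ℂ] F} {K : E →L[ℂ] E}
    (h : PowersDecay V ∨ PowersDecay K) :
    Function.Bijective fun W : E →L[ℂ] F => W - V ∘L W ∘L K := by
  obtain ⟨Φ, hΦ⟩ : ∃ Φ : (E →L[ℂ] F) →L[ℂ] (E →L[ℂ] F), ∀ W, Φ W = V ∘L W ∘L K :=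
    ⟨(ContinuousLinearMap.postcomp E V) ∘L (ContinuousLinearMap.precomp F K), fun W => rfl⟩
  have hpow : ∀ (n : ℕ) (W : E →L[ℂ] F), (Φ ^ n) W = (V ^ n) ∘L W ∘L (K ^ n) := by
    intro n
    induction n with
    | zero => intro W; ext x; simp
    | succ n ih =>
      intro W
      rw [pow_succ', mul_apply_eq_comp, ih, hΦ, pow_succ' V, pow_succ K]
      rfl
  have hdecay : PowersDecay Φ := by
    intro ε hε
    obtain ⟨C, hC, hb⟩ : ∃ C : ℝ, 0 ≤ C ∧ ∀ n : ℕ, ‖V ^ n‖ * ‖K ^ n‖ ≤ C * ε ^ n := by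
      rcases h with h | h
      · exact h.exists_norm_pow_mul_norm_pow_le K hε
      · simpa only [mul_comm ‖V ^ _‖] using h.exists_norm_pow_mul_norm_pow_le V hε
    refine ⟨C, hC, fun n => (ContinuousLinearMap.opNorm_le_bound _ (by positivity)
      fun W => ?_).trans (hb n)⟩
    rw [hpow]
    calc _ ≤ ‖V ^ n‖ * (‖W‖ * ‖K ^ n‖) := (ContinuousLinearMap.opNorm_comp_le _ _).trans
          (mul_le_mul_of_nonneg_left (ContinuousLinearMap.opNorm_comp_le _ _) (norm_nonneg _))
      _ = _ := by ring
  obtain ⟨u, hu⟩ := (hdecay.isUnit_sub (z := 1) one_ne_zero).neg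
  have hW : ∀ W : E →L[ℂ] F, (u : (E →L[ℂ] F) →L[ℂ] (E →L[ℂ] F)) W = W - V ∘L W ∘L K := fun W => by
    rw [hu]; simp [hΦ]
  refine ⟨fun W W' hWW => ?_, fun C => ⟨(u⁻¹).val C, ?_⟩⟩
  · simp only [← hW] at hWW
    have := congrArg (u⁻¹).val hWW
    rwa [← mul_apply_eq_comp, ← mul_apply_eq_comp, u.inv_mul] at this
  · simp only [← hW]
    rw [← mul_apply_eq_comp, u.mul_inv, one_apply_eq_self]

theorem eq_zero_of_comp_comp_eq [CompleteSpace F] {V : F →L[ℂ] F} {K : E →L[ℂ] E}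
    (h : PowersDecay V ∨ PowersDecay K) {W : E →L[ℂ] F} (hW : V ∘L W ∘L K = W) : W = 0 :=
  (bijective_sub_comp_comp h).1 (by simp [hW])

/-- An operator intertwining `T` and `T'` also intertwines the projections onto their
quasi-nilpotent parts. -/
theorem intertwine_projections [CompleteSpace F] {T p l : E →L[ℂ] E} {T' p' l' : F →L[ℂ] F}
    {U : E →L[ℂ] F} (hU : ∀ x, T' (U x) = U (T x))
    (hp : IsQuasinilpotentProj T p) (hl : T * l = 1 - p) (hpl : p * l = 0)
    (hp' : IsQuasinilpotentProj T' p') (hl' : l' * T' = 1 - p') (hlp' : l' * p' = 0) (x : E) :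
    p' (U x) = U (p x) := by
  have i : ∀ x, p (p x) = p x := fun x => DFunLike.congr_fun hp.idem x
  have c : ∀ x, p (T x) = T (p x) := fun x => DFunLike.congr_fun hp.comm x
  have i' : ∀ x, p' (p' x) = p' x := fun x => DFunLike.congr_fun hp'.idem x
  have c' : ∀ x, p' (T' x) = T' (p' x) := fun x => DFunLike.congr_fun hp'.comm x
  have e1 : ∀ x, T (l x) = x - p x := fun x => DFunLike.congr_fun hl x
  have e2 : ∀ x, p (l x) = 0 := fun x => DFunLike.congr_fun hpl x
  have e3 : ∀ x, l' (T' x) = x - p' x := fun x => DFunLike.congr_fun hl' x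
  have e4 : ∀ x, l' (p' x) = 0 := fun x => DFunLike.congr_fun hlp' x
  -- Both off-diagonal blocks of `U` are fixed by a map `W ↦ V W K` with one quasi-nilpotent factor,
  -- hence vanish.
  have h1 : p' ∘L U ∘L (1 - p) = 0 := by
    refine eq_zero_of_comp_comp_eq (V := T' * p') (K := l) (Or.inl hp'.decay) ?_
    ext x
    simp [i', e2, ← c', hU, e1]
  have h2 : (1 - p') ∘L U ∘L p = 0 := by
    refine eq_zero_of_comp_comp_eq (V := l') (K := T * p) (Or.inr hp.decay) ?_
    ext x
    simp [c, i, e4, ← hU, e3]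
  have h1x := DFunLike.congr_fun h1 x
  have h2x := DFunLike.congr_fun h2 x
  simp only [ContinuousLinearMap.comp_apply, sub_apply, one_apply_eq_self, map_sub,
    zero_apply, sub_eq_zero] at h1x h2x
  exact h1x.trans h2x.symm

/-- The off-diagonal entry of a triangular idempotent commuting with a triangular operator. -/
theorem exists_offDiagonal [CompleteSpace E] {A p l : E →L[ℂ] E} {B q m : F →L[ℂ] F}
    (C : F →L[ℂ] E) (hp : IsQuasinilpotentProj A p) (hl : A * l = 1 - p) (hpl : p * l = 0)
    (hq : IsQuasinilpotentProj B q) (hm : m * B = 1 - q) (hmq : m * q = 0) :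
    ∃ S : F →L[ℂ] E, p ∘L S + S ∘L q = S ∧ p ∘L C + S ∘L B = A ∘L S + C ∘L q := by
  have i : ∀ x, p (p x) = p x := fun x => DFunLike.congr_fun hp.idem x
  have c : ∀ x, p (A x) = A (p x) := fun x => DFunLike.congr_fun hp.comm x
  have i' : ∀ x, q (q x) = q x := fun x => DFunLike.congr_fun hq.idem x
  have c' : ∀ x, q (B x) = B (q x) := fun x => DFunLike.congr_fun hq.comm x
  have e1 : ∀ x, A (l x) = x - p x := fun x => DFunLike.congr_fun hl x
  have e2 : ∀ x, p (l x) = 0 := fun x => DFunLike.congr_fun hpl x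
  have e3 : ∀ x, m (B x) = x - q x := fun x => DFunLike.congr_fun hm x
  have e4 : ∀ x, m (q x) = 0 := fun x => DFunLike.congr_fun hmq x
  obtain ⟨S, hS⟩ := (bijective_sub_comp_comp (V := A * p) (K := m) (Or.inl hp.decay)).2 C
  obtain ⟨S', hS'⟩ := (bijective_sub_comp_comp (V := l) (K := B * q) (Or.inr hq.decay)).2 C
  have hS : ∀ y, S y = C y + A (p (S (m y))) := fun y =>
    sub_eq_iff_eq_add.1 (DFunLike.congr_fun hS y)
  have hS' : ∀ y, S' y = C y + l (S' (B (q y))) := fun y =>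
    sub_eq_iff_eq_add.1 (DFunLike.congr_fun hS' y)
  -- Idempotence allows only the blocks `p · (1 - q)` and `(1 - p) · q`. Commutation determines them
  -- separately, through the equations solved by `S` and `S'`.
  refine ⟨-(p ∘L S ∘L m) - l ∘L S' ∘L q, ?_, ?_⟩
  · ext y
    simp [i, i', e2, e4, sub_eq_add_neg]
  · ext y
    have h1 : p (S y) = p (C y) + A (p (S (m y))) := by rw [hS y, map_add, c, i]
    have h2 : p (S (q y)) = p (C (q y)) := by rw [hS (q y), e4]; simp
    have h3 : S' (q y) = C (q y) + l (S' (B (q y))) := by rw [hS' (q y), i']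
    have h4 : p (S' (q y)) = p (C (q y)) := by rw [h3, map_add, e2, add_zero]
    simp only [add_apply, ContinuousLinearMap.comp_apply, sub_apply, neg_apply, e3, c', map_sub,
      map_neg, e1, h1, h2, h4]
    rw [h3]
    abel

end Intertwining

/-! ### Triangular operators on `X × Y` -/

section Triangular

variable {X Y : Type*} [NormedAddCommGroup X] [NormedSpace ℂ X]
  [NormedAddCommGroup Y] [NormedSpace ℂ Y]
  {A : X →L[ℂ] X} {B : Y →L[ℂ] Y} {C : Y →L[ℂ] X}

@[simp]
theorem opMatrix_apply (A : X →L[ℂ] X) (B : Y →L[ℂ] Y) (C : Y →L[ℂ] X) (z : X × Y) :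
    opMatrix A B C z = (A z.1 + C z.2, B z.2) := rfl

theorem opMatrix_mul (A A' : X →L[ℂ] X) (B B' : Y →L[ℂ] Y) (C C' : Y →L[ℂ] X) :
    opMatrix A B C * opMatrix A' B' C' = opMatrix (A * A') (B * B') (A ∘L C' + C ∘L B') :=
  ContinuousLinearMap.ext fun z => by simp [add_assoc]

theorem opMatrix_add (A A' : X →L[ℂ] X) (B B' : Y →L[ℂ] Y) (C C' : Y →L[ℂ] X) :
    opMatrix A B C + opMatrix A' B' C' = opMatrix (A + A') (B + B') (C + C') :=
  ContinuousLinearMap.ext fun z => by simp; abel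

theorem opMatrix_one : opMatrix (1 : X →L[ℂ] X) (1 : Y →L[ℂ] Y) 0 = 1 :=
  ContinuousLinearMap.ext fun z => by simp

theorem opMatrix_sub_algebraMap (A : X →L[ℂ] X) (B : Y →L[ℂ] Y) (C : Y →L[ℂ] X) (z : ℂ) :
    opMatrix A B C - algebraMap ℂ _ z =
      opMatrix (A - algebraMap ℂ _ z) (B - algebraMap ℂ _ z) C :=
  ContinuousLinearMap.ext fun x => by
    simp [Algebra.algebraMap_eq_smul_one, Prod.ext_iff]
    abel

/-- The inverse of a triangular operator with invertible diagonal. -/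
def triangularInverse (r : X →L[ℂ] X) (s : Y →L[ℂ] Y) (C : Y →L[ℂ] X) : (X × Y) →L[ℂ] (X × Y) :=
  opMatrix r s (-(r ∘L C ∘L s))

theorem triangularInverse_mul {r : X →L[ℂ] X} {s : Y →L[ℂ] Y} (hr : r * A = 1) (hs : s * B = 1) :
    triangularInverse r s C * opMatrix A B C = 1 := by
  have hs' : ∀ y, s (B y) = y := fun y => DFunLike.congr_fun hs y
  rw [triangularInverse, opMatrix_mul, hr, hs, ← opMatrix_one]
  congr 1
  ext y
  simp [hs']

theorem mul_triangularInverse {r : X →L[ℂ] X} {s : Y →L[ℂ] Y} (hr : A * r = 1) (hs : B * s = 1) :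
    opMatrix A B C * triangularInverse r s C = 1 := by
  have hr' : ∀ x, A (r x) = x := fun x => DFunLike.congr_fun hr x
  rw [triangularInverse, opMatrix_mul, hr, hs, ← opMatrix_one]
  congr 1
  ext y
  simp [hr']

theorem isUnit_opMatrix (hA : IsUnit A) (hB : IsUnit B) : IsUnit (opMatrix A B C) := by
  obtain ⟨u, rfl⟩ := hA
  obtain ⟨v, rfl⟩ := hB
  exact ⟨⟨_, triangularInverse (u⁻¹).val (v⁻¹).val C,
    mul_triangularInverse u.mul_inv v.mul_inv, triangularInverse_mul u.inv_mul v.inv_mul⟩, rfl⟩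

theorem leftInverse_fst_of_opMatrix {R : (X × Y) →L[ℂ] (X × Y)} (hR : R * opMatrix A B C = 1) :
    ∃ r, r * A = 1 :=
  ⟨ContinuousLinearMap.fst ℂ X Y ∘L R ∘L ContinuousLinearMap.inl ℂ X Y, by
    ext x
    have := DFunLike.congr_fun hR (x, 0)
    rw [mul_apply_eq_comp, opMatrix_apply] at this
    simpa using congrArg Prod.fst this⟩

theorem rightInverse_snd_of_opMatrix {R : (X × Y) →L[ℂ] (X × Y)} (hR : opMatrix A B C * R = 1) :
    ∃ r, B * r = 1 :=
  ⟨ContinuousLinearMap.snd ℂ X Y ∘L R ∘L ContinuousLinearMap.inr ℂ X Y, by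
    ext y
    have := DFunLike.congr_fun hR (0, y)
    rw [mul_apply_eq_comp, opMatrix_apply] at this
    simpa using congrArg Prod.snd this⟩

variable [CompleteSpace X] [CompleteSpace Y]

/-- For `z ≠ 0` both diagonal entries of `M - z` are invertible, hence so is `M - z`, whatever the
corner. -/
theorem powersDecay_opMatrix (hA : PowersDecay A) (hB : PowersDecay B) :
    PowersDecay (opMatrix A B C) := by
  rw [powersDecay_iff_spectralRadius_eq_zero, spectralRadius_eq_zero_iff]
  intro z hz
  rw [← neg_sub, opMatrix_sub_algebraMap]
  exact (isUnit_opMatrix (hA.isUnit_sub hz) (hB.isUnit_sub hz)).neg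

theorem exists_isQuasinilpotentProj_opMatrix {p l : X →L[ℂ] X} {q m : Y →L[ℂ] Y}
    (C : Y →L[ℂ] X) (hp : IsQuasinilpotentProj A p) (hl : A * l = 1 - p) (hpl : p * l = 0)
    (hq : IsQuasinilpotentProj B q) (hm : m * B = 1 - q) (hmq : m * q = 0) :
    ∃ S : Y →L[ℂ] X, IsQuasinilpotentProj (opMatrix A B C) (opMatrix p q S) := by
  obtain ⟨S, h1, h2⟩ := exists_offDiagonal C hp hl hpl hq hm hmq
  refine ⟨S, ?_, ?_, ?_⟩
  · rw [opMatrix_mul, hp.idem, hq.idem, h1]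
  · rw [opMatrix_mul, opMatrix_mul, hp.comm, hq.comm, h2]
  · rw [opMatrix_mul]
    exact powersDecay_opMatrix hp.decay hq.decay

/-- A triangular operator is left generalized Drazin invertible if its diagonal entries are, the
first one two-sidedly. -/
theorem isLeftGenDrazin_opMatrix {p : X →L[ℂ] X} (hp : IsQuasinilpotentProj A p)
    (hl : ∃ r, r * (A + p) = 1) (hr : ∃ r, (A + p) * r = 1) (hB : IsLeftGenDrazin B)
    (C : Y →L[ℂ] X) : IsLeftGenDrazin (opMatrix A B C) := by
  obtain ⟨r, hr⟩ := hr
  obtain ⟨r', hr'⟩ := hl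
  obtain ⟨q, hq, s, hs⟩ := isLeftGenDrazin_iff.1 hB
  -- The corner of the idempotent needs a right inverse on the `A` side; the final left inverse
  -- needs `r'`. Hence the two-sided hypothesis on `A`.
  obtain ⟨l, hl, -, hpl⟩ := hp.exists_rightInverse hr
  obtain ⟨m, hm, hmq, -⟩ := hq.exists_leftInverse hs
  obtain ⟨S, hS⟩ := exists_isQuasinilpotentProj_opMatrix C hp hl hpl hq hm hmq
  refine isLeftGenDrazin_iff.2 ⟨_, hS, triangularInverse r' s (C + S), ?_⟩
  rw [opMatrix_add, triangularInverse_mul hr' hs]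

/-- A triangular operator is right generalized Drazin invertible if its diagonal entries are, the
second one two-sidedly. -/
theorem isRightGenDrazin_opMatrix {q : Y →L[ℂ] Y} (hq : IsQuasinilpotentProj B q)
    (hl : ∃ r, r * (B + q) = 1) (hr : ∃ r, (B + q) * r = 1) (hA : IsRightGenDrazin A)
    (C : Y →L[ℂ] X) : IsRightGenDrazin (opMatrix A B C) := by
  obtain ⟨s, hs⟩ := hl
  obtain ⟨s', hs'⟩ := hr
  obtain ⟨p, hp, r, hr⟩ := isRightGenDrazin_iff.1 hA
  obtain ⟨l, hl, -, hpl⟩ := hp.exists_rightInverse hr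
  obtain ⟨m, hm, hmq, -⟩ := hq.exists_leftInverse hs
  obtain ⟨S, hS⟩ := exists_isQuasinilpotentProj_opMatrix C hp hl hpl hq hm hmq
  refine isRightGenDrazin_iff.2 ⟨_, hS, triangularInverse r s' (C + S), ?_⟩
  rw [opMatrix_add, mul_triangularInverse hr hs']

/-- If `M` is left and `A` two-sidedly generalized Drazin invertible, then the quotient `B` is left
generalized Drazin invertible. -/
theorem isLeftGenDrazin_of_opMatrix {p : X →L[ℂ] X} (hp : IsQuasinilpotentProj A p)
    (hr : ∃ r, (A + p) * r = 1) (hM : IsLeftGenDrazin (opMatrix A B C)) : IsLeftGenDrazin B := by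
  obtain ⟨P, hP, R, hR⟩ := isLeftGenDrazin_iff.1 hM
  obtain ⟨g, hg⟩ := hr
  obtain ⟨l, hl, -, hpl⟩ := hp.exists_rightInverse hg
  obtain ⟨l', hl', hlp', -⟩ := hP.exists_leftInverse hR
  -- `P` preserves `X × 0`, and below so does `R`; both therefore induce operators on the quotient
  -- `Y`.
  have hPι : ∀ x, P (x, 0) = (p x, 0) := fun x =>
    intertwine_projections (U := ContinuousLinearMap.inl ℂ X Y) (fun x => by simp) hp hl hpl hP hl'
      hlp' x
  have hg' : ∀ x, (A + p) (g x) = x := fun x => DFunLike.congr_fun hg x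
  have hR' : ∀ z, R (opMatrix A B C z + P z) = z := fun z => DFunLike.congr_fun hR z
  have hRι : ∀ x, R (x, 0) = (g x, 0) := fun x => by
    rw [← hR' (g x, 0), hPι]
    congr 1
    simpa using (hg' x).symm
  have split : ∀ z : X × Y, z = (z.1, 0) + (0, z.2) := fun z => by simp
  set Q : Y →L[ℂ] Y := ContinuousLinearMap.snd ℂ X Y ∘L P ∘L ContinuousLinearMap.inr ℂ X Y with hQ
  set m : Y →L[ℂ] Y := ContinuousLinearMap.snd ℂ X Y ∘L R ∘L ContinuousLinearMap.inr ℂ X Y with hm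
  have hπP : ∀ z, (P z).2 = Q z.2 := fun z => by
    conv_lhs => rw [split z, map_add, hPι]
    simp [hQ]
  have hπR : ∀ z, (R z).2 = m z.2 := fun z => by
    conv_lhs => rw [split z, map_add, hRι]
    simp [hm]
  have i : ∀ z, P (P z) = P z := fun z => DFunLike.congr_fun hP.idem z
  have c : ∀ z, P (opMatrix A B C z) = opMatrix A B C (P z) := fun z => DFunLike.congr_fun hP.comm z
  refine isLeftGenDrazin_iff.2 ⟨Q, ⟨?_, ?_, ?_⟩, m, ?_⟩
  · ext y
    have := congrArg Prod.snd (i (0, y))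
    rwa [hπP, hπP] at this
  · ext y
    have := congrArg Prod.snd (c (0, y))
    rwa [hπP, opMatrix_apply, opMatrix_apply, hπP] at this
  · have hpow : ∀ (n : ℕ) (z : X × Y), (((opMatrix A B C * P) ^ n) z).2 = ((B * Q) ^ n) z.2 := by
      intro n
      induction n with
      | zero => intro z; simp
      | succ n ih =>
        intro z
        rw [pow_succ, pow_succ, mul_apply_eq_comp, mul_apply_eq_comp, ih]
        simp [hπP]
    refine powersDecay_of_le hP.decay zero_le_one fun n =>
      ContinuousLinearMap.opNorm_le_bound _ (by positivity) fun y => ?_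
    rw [one_mul, ← hpow _ ((0, y) : X × Y)]
    refine (norm_snd_le _).trans ((ContinuousLinearMap.le_opNorm _ _).trans (le_of_eq ?_))
    simp
  · ext y
    have := congrArg Prod.snd (hR' (0, y))
    rw [hπR] at this
    simpa [hπP] using this

/-- If `M` is right and `B` two-sidedly generalized Drazin invertible, then the restriction `A` is
right generalized Drazin invertible. -/
theorem isRightGenDrazin_of_opMatrix {q : Y →L[ℂ] Y} (hq : IsQuasinilpotentProj B q)
    (hl : ∃ r, r * (B + q) = 1) (hM : IsRightGenDrazin (opMatrix A B C)) : IsRightGenDrazin A := by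
  obtain ⟨P, hP, R, hR⟩ := isRightGenDrazin_iff.1 hM
  obtain ⟨g, hg⟩ := hl
  obtain ⟨l, hl, -, hpl⟩ := hP.exists_rightInverse hR
  obtain ⟨l', hl', hlp', -⟩ := hq.exists_leftInverse hg
  have hπP : ∀ z, (P z).2 = q z.2 := fun z =>
    (intertwine_projections (U := ContinuousLinearMap.snd ℂ X Y) (fun x => by simp) hP hl hpl hq hl'
      hlp' z).symm
  have hg' : ∀ y, g (B y + q y) = y := fun y => DFunLike.congr_fun hg y
  have hR' : ∀ z, opMatrix A B C (R z) + P (R z) = z := fun z => DFunLike.congr_fun hR z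
  -- The second coordinate of `R (x, 0)` is killed by the injective `B + q`, so `R` restricts to
  -- `X`.
  have hπR : ∀ x : X, (R (x, 0)).2 = 0 := fun x => by
    have := congrArg Prod.snd (hR' (x, 0))
    rw [Prod.snd_add, hπP, opMatrix_apply] at this
    rw [← hg' (R (x, 0)).2, this, map_zero]
  set Q : X →L[ℂ] X := ContinuousLinearMap.fst ℂ X Y ∘L P ∘L ContinuousLinearMap.inl ℂ X Y with hQ
  set r : X →L[ℂ] X := ContinuousLinearMap.fst ℂ X Y ∘L R ∘L ContinuousLinearMap.inl ℂ X Y with hr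
  have hPι : ∀ x, P (x, 0) = (Q x, 0) := fun x => Prod.ext rfl (by rw [hπP]; simp)
  have hRι : ∀ x, R (x, 0) = (r x, 0) := fun x => Prod.ext rfl (hπR x)
  have hMι : ∀ x, opMatrix A B C (x, 0) = (A x, 0) := fun x => by simp
  have i : ∀ z, P (P z) = P z := fun z => DFunLike.congr_fun hP.idem z
  have c : ∀ z, P (opMatrix A B C z) = opMatrix A B C (P z) := fun z => DFunLike.congr_fun hP.comm z
  refine isRightGenDrazin_iff.2 ⟨Q, ⟨?_, ?_, ?_⟩, r, ?_⟩
  · refine ContinuousLinearMap.ext fun x => ?_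
    have := i (x, 0)
    rw [hPι, hPι] at this
    exact (Prod.ext_iff.1 this).1
  · refine ContinuousLinearMap.ext fun x => ?_
    have := c (x, 0)
    rw [hPι, hMι, hMι, hPι] at this
    exact (Prod.ext_iff.1 this).1
  · have hpow : ∀ (n : ℕ) (x : X), ((opMatrix A B C * P) ^ n) (x, 0) = (((A * Q) ^ n) x, 0) := by
      intro n
      induction n with
      | zero => intro x; simp
      | succ n ih =>
        intro x
        rw [pow_succ, pow_succ, mul_apply_eq_comp, mul_apply_eq_comp, mul_apply_eq_comp, hPι, hMι,
          ih, mul_apply_eq_comp]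
    refine powersDecay_of_le hP.decay zero_le_one fun n =>
      ContinuousLinearMap.opNorm_le_bound _ (by positivity) fun x => ?_
    have h1 := ContinuousLinearMap.le_opNorm ((opMatrix A B C * P) ^ (n + 1)) ((x, 0) : X × Y)
    rw [hpow] at h1
    simpa using h1
  · ext x
    have := hR' (x, 0)
    rw [hRι, hPι, hMι] at this
    exact (Prod.ext_iff.1 this).1

end Triangular

/-! ### Combining the SVEP with the triangular algebra -/

section Spectra

variable {X Y : Type*} [NormedAddCommGroup X] [NormedSpace ℂ X] [CompleteSpace X]
  [NormedAddCommGroup Y] [NormedSpace ℂ Y] [CompleteSpace Y]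

/-- The SVEP makes the nearby translates invertible, so `z` is at worst isolated in the spectrum and
the Riesz projection applies. -/
theorem exists_proj_of_leftInverse_sub {T : X →L[ℂ] X} (hT : HasSVEP (adj T)) (z : ℂ)
    (h : ∃ ε : ℝ, 0 < ε ∧ ∀ w : ℂ, w ≠ 0 → ‖w‖ < ε →
      ∃ s, s * (T - algebraMap ℂ _ z - algebraMap ℂ _ w) = 1) :
    ∃ p, IsQuasinilpotentProj (T - algebraMap ℂ _ z) p ∧
      (∃ r, r * (T - algebraMap ℂ _ z + p) = 1) ∧ ∃ r, (T - algebraMap ℂ _ z + p) * r = 1 := by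
  obtain ⟨ε, hε, h⟩ := h
  refine exists_isQuasinilpotentProj_isUnit hε fun w h0 h1 => ?_
  obtain ⟨s, hs⟩ := h w h0 h1
  rw [sub_sub, ← map_add] at hs ⊢
  exact isUnit_of_leftInverse_of_adj_hasSVEP hT hs

theorem exists_proj_of_rightInverse_sub {T : X →L[ℂ] X} (hT : HasSVEP T) (z : ℂ)
    (h : ∃ ε : ℝ, 0 < ε ∧ ∀ w : ℂ, w ≠ 0 → ‖w‖ < ε →
      ∃ s, (T - algebraMap ℂ _ z - algebraMap ℂ _ w) * s = 1) :
    ∃ p, IsQuasinilpotentProj (T - algebraMap ℂ _ z) p ∧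
      (∃ r, r * (T - algebraMap ℂ _ z + p) = 1) ∧ ∃ r, (T - algebraMap ℂ _ z + p) * r = 1 := by
  obtain ⟨ε, hε, h⟩ := h
  refine exists_isQuasinilpotentProj_isUnit hε fun w h0 h1 => ?_
  obtain ⟨s, hs⟩ := h w h0 h1
  rw [sub_sub, ← map_add] at hs ⊢
  exact hT.isUnit_of_rightInverse hs

theorem isLeftGenDrazin_opMatrix_iff {A : X →L[ℂ] X} (hA : HasSVEP (adj A)) (B : Y →L[ℂ] Y)
    (C : Y →L[ℂ] X) (z : ℂ) :
    IsLeftGenDrazin (opMatrix A B C - algebraMap ℂ _ z) ↔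
      IsLeftGenDrazin (A - algebraMap ℂ _ z) ∧ IsLeftGenDrazin (B - algebraMap ℂ _ z) := by
  constructor
  · intro h
    obtain ⟨P, hP, R, hR⟩ := isLeftGenDrazin_iff.1 h
    obtain ⟨ε, hε, hs⟩ := hP.leftInverse_sub_of_small hR
    obtain ⟨p, hp, hl, hr⟩ := exists_proj_of_leftInverse_sub hA z ⟨ε, hε, fun w h0 h1 => by
      obtain ⟨s, hs⟩ := hs w h0 h1
      rw [opMatrix_sub_algebraMap, opMatrix_sub_algebraMap] at hs
      exact leftInverse_fst_of_opMatrix hs⟩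
    rw [opMatrix_sub_algebraMap] at h
    exact ⟨isLeftGenDrazin_iff.2 ⟨p, hp, hl⟩, isLeftGenDrazin_of_opMatrix hp hr h⟩
  · rintro ⟨h1, h2⟩
    obtain ⟨P, hP, R, hR⟩ := isLeftGenDrazin_iff.1 h1
    obtain ⟨p, hp, hl, hr⟩ := exists_proj_of_leftInverse_sub hA z (hP.leftInverse_sub_of_small hR)
    rw [opMatrix_sub_algebraMap]
    exact isLeftGenDrazin_opMatrix hp hl hr h2 C

theorem isRightGenDrazin_opMatrix_iff (A : X →L[ℂ] X) {B : Y →L[ℂ] Y} (hB : HasSVEP B)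
    (C : Y →L[ℂ] X) (z : ℂ) :
    IsRightGenDrazin (opMatrix A B C - algebraMap ℂ _ z) ↔
      IsRightGenDrazin (A - algebraMap ℂ _ z) ∧ IsRightGenDrazin (B - algebraMap ℂ _ z) := by
  constructor
  · intro h
    obtain ⟨P, hP, R, hR⟩ := isRightGenDrazin_iff.1 h
    obtain ⟨ε, hε, hs⟩ := hP.rightInverse_sub_of_small hR
    obtain ⟨p, hp, hl, hr⟩ := exists_proj_of_rightInverse_sub hB z ⟨ε, hε, fun w h0 h1 => by
      obtain ⟨s, hs⟩ := hs w h0 h1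
      rw [opMatrix_sub_algebraMap, opMatrix_sub_algebraMap] at hs
      exact rightInverse_snd_of_opMatrix hs⟩
    rw [opMatrix_sub_algebraMap] at h
    exact ⟨isRightGenDrazin_of_opMatrix hp hl h, isRightGenDrazin_iff.2 ⟨p, hp, hr⟩⟩
  · rintro ⟨h1, h2⟩
    obtain ⟨P, hP, R, hR⟩ := isRightGenDrazin_iff.1 h2
    obtain ⟨p, hp, hl, hr⟩ := exists_proj_of_rightInverse_sub hB z (hP.rightInverse_sub_of_small hR)
    rw [opMatrix_sub_algebraMap]
    exact isRightGenDrazin_opMatrix hp hl hr h1 C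

end Spectra

end GenDrazin

theorem mainTheorem8 {X Y : Type*}
    [NormedAddCommGroup X] [NormedSpace ℂ X] [CompleteSpace X]
    [NormedAddCommGroup Y] [NormedSpace ℂ Y] [CompleteSpace Y] :
    (∀ A : X →L[ℂ] X, GenDrazin.HasSVEP (GenDrazin.adj A) →
      ∀ (B : Y →L[ℂ] Y) (C : Y →L[ℂ] X),
        GenDrazin.leftGenDrazinSpectrum (GenDrazin.opMatrix A B C) =
          GenDrazin.leftGenDrazinSpectrum A ∪ GenDrazin.leftGenDrazinSpectrum B) ∧
    (∀ B : Y →L[ℂ] Y, GenDrazin.HasSVEP B →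
      ∀ (A : X →L[ℂ] X) (C : Y →L[ℂ] X),
        GenDrazin.rightGenDrazinSpectrum (GenDrazin.opMatrix A B C) =
          GenDrazin.rightGenDrazinSpectrum A ∪ GenDrazin.rightGenDrazinSpectrum B) := by
  refine ⟨fun A hA B C => Set.ext fun z => ?_, fun B hB A C => Set.ext fun z => ?_⟩
  · have := GenDrazin.isLeftGenDrazin_opMatrix_iff hA B C z
    simp only [Algebra.algebraMap_eq_smul_one, ContinuousLinearMap.one_def] at this
    simp only [GenDrazin.leftGenDrazinSpectrum, Set.mem_union, Set.mem_ofPred_eq, this]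
    tauto
  · have := GenDrazin.isRightGenDrazin_opMatrix_iff A hB C z
    simp only [Algebra.algebraMap_eq_smul_one, ContinuousLinearMap.one_def] at this
    simp only [GenDrazin.rightGenDrazinSpectrum, Set.mem_union, Set.mem_ofPred_eq, this]
    tauto
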